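/- **Theorem (two axis agreement).** Consider $n$ robots, modelled as points that are initially at arbitrary distinct positions of the Euclidean plane. They are anonymous, identical and run the same deterministic algorithm. They have no common global coordinate system: each robot has a persistent local coordinate system, centred at its current position, with its own unit of length, but all robots agree on the direction and orientation of both coordinate axes (*two axis agreement*). The robots are *opaque*: a robot sees another robot if and only if no third robot lies on the segment joining them. They are *luminous*: each carries a visible, persistent light whose colour belongs to a fixed finite set, and initially all lights have the same specified colour `off`. Apart from its own colour a robot has no memory. Every robot receives as input the same pattern $\mathbb P$, a list of $n$ distinct points of $\mathbb R^2$. The robots work asynchronously (ASync). Each robot repeats cycles forever: it takes an instantaneous snapshot of the positions (in its local coordinates) and colours of the robots visible to it (LOOK); from the input, the snapshot and its own colour the algorithm determines a new colour and a destination, and the robot sets its light to that colour (COMPUTE); then it moves along the segment to the destination, which it always reaches (MOVE, rigid movement), after which it is inactive for some time. All durations, and the speed during a movement, are chosen by an adversary for each robot and cycle independently; they are finite but unbounded, every robot performs infinitely many cycles, and only finitely many in bounded time. A robot can be seen while it is moving. A robot is *stable* at time $t$ if it is not moving and has no decided but not yet executed change of colour or movement. The configuration at time $t$ is *final* if every robot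 is stable at $t$ and no robot taking a snapshot at $t$ would decide to move or to change its colour. Then Arbitrary Pattern Formation is deterministically solvable from every initial configuration using three colours. That is, there is one deterministic algorithm using three colours such that for every $n$, every pattern $\mathbb P$ of $n$ distinct points, every initial configuration of $n$ robots at distinct positions with all lights `off`, every choice of local coordinate systems with two axis agreement, and every asynchronous execution, there is a time $t\ge 0$ such that 1. the configuration at time $t$ is final; 2. all lights have the same colour at time $t$; 3. the set of points of $\mathbb P$ is obtained from the set of positions of the robots at time $t$ by a composition of translations, rotations, reflections and uniform scalings; 4. no two robots occupy the same position at any time $t'\in[0,t]$. -/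

import Mathlib

open Set Filter

noncomputable section

namespace Robots

/-- The Euclidean plane. -/
abbrev Plane : Type := EuclideanSpace ℝ (Fin 2)

/-- The part of a robot's local coordinate system that never changes: its unit of length and
the directions of its axes. The origin is always the current position of the robot. -/
structure Frame where
  /-- the length, in the ambient plane, of one local unit -/
  unit : ℝ
  unit_pos : 0 < unit
  /-- the linear isometry that turns ambient vectors into vectors along the local axes;
  it may be a rotation or a reflection -/
  axes : Plane ≃ₗᵢ[ℝ] Plane

/-- Local coordinates of the point `x` for a robot with frame `F` placed at `o`. -/
def Frame.toLocal (F : Frame) (o x : Plane) : Plane := F.unit⁻¹ • F.axes (x - o)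

/-- The point whose local coordinates are `y` for a robot with frame `F` placed at `o`. -/
def Frame.toGlobal (F : Frame) (o y : Plane) : Plane := o + F.unit • F.axes.symm y

/-- Both axes have the same direction and orientation for all robots; units are unrelated. -/
def TwoAxisAgreement {n : ℕ} (F : Fin n → Frame) : Prop :=
  ∀ r s, (F r).axes = (F s).axes

/-- A deterministic algorithm for robots with lights in `C`, the same for all robots. Its
arguments are the input pattern (a list of `n` points), the colour of the executing robot, and
its snapshot: the local positions of the other robots visible to it, with their colours. It
returns the new colour and the destination in local coordinates (`0` is "stay"). It has no
access to the identity of a robot, to earlier snapshots or to the time. -/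
abbrev Algorithm (C : Type) : Type :=
  (n : ℕ) → (Fin n → Plane) → C → Set (Plane × C) → C × Plane

/-- Opaque robots at positions `p`: `r` sees `s` iff no other robot lies on the segment
joining them. -/
def Visible {n : ℕ} (p : Fin n → Plane) (r s : Fin n) : Prop :=
  ∀ u, u ≠ r → u ≠ s → p u ∉ segment ℝ (p r) (p s)

/-- What robot `r` perceives when the robots are at `p` with colours `c`. -/
def snapshot {n : ℕ} {C : Type} (F : Frame) (p : Fin n → Plane) (c : Fin n → C) (r : Fin n) :
    Set (Plane × C) :=
  {z | ∃ s, s ≠ r ∧ Visible p r s ∧ z = (F.toLocal (p r) (p s), c s)}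

/-- The data of a behaviour of `n` robots over the time interval `[0, ∞)`: the frames, the
positions and colours as functions of time, and the instants at which robot `r`, in its
`k`-th cycle, takes its snapshot, sets its light, starts moving and ends moving. -/
structure Run (n : ℕ) (C : Type) where
  frame : Fin n → Frame
  pos : Fin n → ℝ → Plane
  light : Fin n → ℝ → C
  look : Fin n → ℕ → ℝ
  compute : Fin n → ℕ → ℝ
  moveStart : Fin n → ℕ → ℝ
  moveEnd : Fin n → ℕ → ℝ

namespace Run

variable {n : ℕ} {C : Type}

/-- The output of `A` for robot `r` on a snapshot taken at time `t`. -/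
def decision (R : Run n C) (A : Algorithm C) (P : Fin n → Plane) (r : Fin n) (t : ℝ) :
    C × Plane :=
  A n P (R.light r t) (snapshot (R.frame r) (fun s => R.pos s t) (fun s => R.light s t) r)

/-- The colour chosen by robot `r` on a snapshot taken at time `t`. -/
def newColor (R : Run n C) (A : Algorithm C) (P : Fin n → Plane) (r : Fin n) (t : ℝ) : C :=
  (R.decision A P r t).1

/-- The destination, as a point of the ambient plane, chosen by robot `r` on a snapshot taken
at time `t`. -/
def dest (R : Run n C) (A : Algorithm C) (P : Fin n → Plane) (r : Fin n) (t : ℝ) : Plane :=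
  (R.frame r).toGlobal (R.pos r t) (R.decision A P r t).2

/-- `R` is an asynchronous execution of `A` with input `P` and rigid movements that starts with
all robots inactive and all lights `off`. The durations of the phases are chosen
independently for each robot and each cycle. -/
structure IsExecution (R : Run n C) (off : C) (A : Algorithm C) (P : Fin n → Plane) : Prop where
  look_nonneg : ∀ r, 0 ≤ R.look r 0
  look_lt_compute : ∀ r k, R.look r k < R.compute r k
  compute_le_moveStart : ∀ r k, R.compute r k ≤ R.moveStart r k
  moveStart_lt_moveEnd : ∀ r k, R.moveStart r k < R.moveEnd r k
  moveEnd_le_look : ∀ r k, R.moveEnd r k ≤ R.look r (k + 1)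
  /-- every robot completes infinitely many cycles, finitely many in bounded time -/
  look_tendsto : ∀ r, Tendsto (R.look r) atTop atTop
  light_init : ∀ r t, 0 ≤ t → t < R.compute r 0 → R.light r t = off
  light_cycle : ∀ r k t, R.compute r k ≤ t → t < R.compute r (k + 1) →
    R.light r t = R.newColor A P r (R.look r k)
  pos_init : ∀ r t, 0 ≤ t → t ≤ R.moveStart r 0 → R.pos r t = R.pos r 0
  /-- in the move phase the robot goes along the segment from its position to its destination,
  continuously, never backwards, at a speed that the scheduler controls -/
  pos_move : ∀ r k, ∃ φ : ℝ → ℝ,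
    ContinuousOn φ (Icc (R.moveStart r k) (R.moveEnd r k)) ∧
    MonotoneOn φ (Icc (R.moveStart r k) (R.moveEnd r k)) ∧
    φ (R.moveStart r k) = 0 ∧ φ (R.moveEnd r k) = 1 ∧
    ∀ t ∈ Icc (R.moveStart r k) (R.moveEnd r k),
      R.pos r t = AffineMap.lineMap (R.pos r (R.look r k)) (R.dest A P r (R.look r k)) (φ t)
  pos_rest : ∀ r k t, R.moveEnd r k ≤ t → t ≤ R.moveStart r (k + 1) →
    R.pos r t = R.dest A P r (R.look r k)

/-- At time `t` robot `r` has decided, on an earlier snapshot, to change its colour or to move,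
and has not yet changed its colour (if it is not to move) or started to move (if it is). -/
def HasPendingMove (R : Run n C) (A : Algorithm C) (P : Fin n → Plane) (r : Fin n) (t : ℝ) :
    Prop :=
  ∃ k, (R.newColor A P r (R.look r k) ≠ R.light r (R.look r k) ∧
      t ∈ Ioo (R.look r k) (R.compute r k)) ∨
    (R.dest A P r (R.look r k) ≠ R.pos r (R.look r k) ∧
      t ∈ Ioc (R.look r k) (R.moveStart r k))

/-- At time `t` robot `r` is in the course of a movement to a point other than its starting
point. -/
def IsMoving (R : Run n C) (A : Algorithm C) (P : Fin n → Plane) (r : Fin n) (t : ℝ) : Prop :=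
  ∃ k, R.dest A P r (R.look r k) ≠ R.pos r (R.look r k) ∧
    t ∈ Ioo (R.moveStart r k) (R.moveEnd r k)

/-- Robot `r` is stationary at time `t` and has no pending move. -/
def IsStable (R : Run n C) (A : Algorithm C) (P : Fin n → Plane) (r : Fin n) (t : ℝ) : Prop :=
  ¬ R.IsMoving A P r t ∧ ¬ R.HasPendingMove A P r t

/-- The configuration at time `t` is final: every robot is stable, and no robot that would take
a snapshot at `t` would decide to move or to change its colour. -/
def IsFinal (R : Run n C) (A : Algorithm C) (P : Fin n → Plane) (t : ℝ) : Prop :=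
  (∀ r, R.IsStable A P r t) ∧
    ∀ r, R.newColor A P r t = R.light r t ∧ R.dest A P r t = R.pos r t

end Run

/-- The point set of `P` is obtained from the point set of `p` by translation, reflection,
rotation and uniform scaling. -/
def FormsPattern {n : ℕ} (p P : Fin n → Plane) : Prop :=
  ∃ (c : ℝ) (L : Plane ≃ₗᵢ[ℝ] Plane) (v : Plane), 0 < c ∧
    (fun x => c • L x + v) '' range p = range P

/-- In the run `R` the pattern `P` is formed without collision: at some time the configuration
is final, all lights have the same colour, the robots form `P`, and no two robots have shared
a position up to that time. -/
def AchievesAPF {n : ℕ} {C : Type} (R : Run n C) (A : Algorithm C) (P : Fin n → Plane) : Prop :=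
  ∃ t, 0 ≤ t ∧ R.IsFinal A P t ∧ (∃ c, ∀ r, R.light r t = c) ∧
    FormsPattern (fun r => R.pos r t) P ∧
    ∀ t' ∈ Icc 0 t, Function.Injective fun r => R.pos r t'

end Robots

end

/-!
The robots agree on the axes, hence on the lexicographic order of the plane by height and then
by abscissa (`key`). A robot lying on the segment that joins two others is lexicographically
between them, so robots that are adjacent in this order see each other whatever the
configuration is (`visible_of_adjacent`). The algorithm never changes the order of the robots;
in particular they never collide.

Robots are placed on a copy `T + s • P` of the pattern from the top downwards. A robot of colour
`0` acts only if all robots that it sees above itself have the colour `2` of placed robots. Since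
it sees its successor, the one robot that acts is the highest robot that is not placed. This
robot moves inside the lexicographic gap between its neighbours, which is convex, so all others
keep waiting while they observe it on its way (`Stage.soloStep`). First it climbs a little to be
alone at its height. Then it makes unit shifts to the right. Each line through two other robots
obstructs its view at most once, so eventually it sees all robots, and it knows this because it
knows their number (`exists_shift_visible`). It then knows which points of a copy of the pattern
are occupied, goes with colour `1` to the highest free point of such a copy, and turns its light
to `2` on arrival. The copy is required to be higher than all robots still waiting; this keeps
the target inside the gap and makes room for the next robot. The first robot may use any copy
that is high enough, and once two robots are placed, the copy is determined.

At each moment at most one robot has a decision other than to stay, and this makes asynchrony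
harmless. The configurations observed during a step of the acting robot `a` are those in which
`a` is on its segment and the others have not changed; as the others decide to stay in all of
them, each execution performs the step (`Run.QuietAt.soloStep`). So the asynchronous problem
reduces to reachability by `SoloStep`s, which is solved by induction on the number of robots not
yet placed (`Partial.exists_all`).
-/

noncomputable section

namespace Robots

/-! ### Executions in which one robot acts at a time -/

/-- The new colour and the destination, in the ambient plane, that robot `r` chooses on a
snapshot of the configuration with positions `p` and colours `c`. -/
def act {n : ℕ} {C : Type} (A : Algorithm C) (P : Fin n → Plane) (F : Fin n → Frame)
    (p : Fin n → Plane) (c : Fin n → C) (r : Fin n) : C × Plane :=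
  ((A n P (c r) (snapshot (F r) p c r)).1,
    (F r).toGlobal (p r) (A n P (c r) (snapshot (F r) p c r)).2)

/-- One robot `a` acts alone: every other robot decides to stay in each configuration that it
may observe before the action of `a` is completed. -/
inductive SoloStep {n : ℕ} {C : Type} (A : Algorithm C) (P : Fin n → Plane)
    (F : Fin n → Frame) :
    (Fin n → Plane) × (Fin n → C) → (Fin n → Plane) × (Fin n → C) → Prop
  /-- `a` changes its colour in place; the step is completed by the change of colour, and the
  other robots may react to the new colour -/
  | recolour (p : Fin n → Plane) (c : Fin n → C) (a : Fin n) (e : C)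
      (h : act A P F p c a = (e, p a))
      (ho : ∀ s, s ≠ a → act A P F p c s = (c s, p s)) :
      SoloStep A P F (p, c) (p, Function.update c a e)
  /-- `a` sets its light to `e` and goes to `d` -/
  | move (p : Fin n → Plane) (c : Fin n → C) (a : Fin n) (e : C) (d : Plane)
      (h : act A P F p c a = (e, d))
      (ho : ∀ s, s ≠ a → act A P F p c s = (c s, p s))
      (hm : ∀ φ ∈ Icc (0 : ℝ) 1,
        Function.Injective (Function.update p a (AffineMap.lineMap (p a) d φ)) ∧
        ∀ s, s ≠ a → act A P F (Function.update p a (AffineMap.lineMap (p a) d φ))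
          (Function.update c a e) s = (c s, p s)) :
      SoloStep A P F (p, c) (Function.update p a d, Function.update c a e)

namespace Run

variable {n : ℕ} {C : Type}

/-- From time `t` on, robot `r` keeps position `x` and colour `e` until it executes the decision
of its cycle `k`, whose snapshot is not taken before `t`; whatever it decided earlier has been
executed by time `t`. -/
structure QuietFrom (R : Run n C) (A : Algorithm C) (P : Fin n → Plane) (r : Fin n) (k : ℕ)
    (t : ℝ) (x : Plane) (e : C) : Prop where
  le_look : t ≤ R.look r k
  light_eq : ∀ t', t ≤ t' → t' < R.compute r k → R.light r t' = e
  pos_eq : ∀ t', t ≤ t' → t' ≤ R.moveStart r k → R.pos r t' = x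
  light_past : ∀ i < k, R.newColor A P r (R.look r i) = R.light r (R.look r i) ∨
    R.compute r i ≤ t
  pos_past : ∀ i < k, R.dest A P r (R.look r i) = R.pos r (R.look r i) ∨ R.moveEnd r i ≤ t

/-- At time `t` the configuration is `x`, and no robot has a decision left to execute. -/
def QuietAt (R : Run n C) (A : Algorithm C) (P : Fin n → Plane) (t : ℝ)
    (x : (Fin n → Plane) × (Fin n → C)) : Prop :=
  ∀ r, ∃ k, R.QuietFrom A P r k t (x.1 r) (x.2 r)

variable {R : Run n C} {off : C} {A : Algorithm C} {P : Fin n → Plane}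

theorem act_eq (R : Run n C) (A : Algorithm C) (P : Fin n → Plane) (r : Fin n) (t : ℝ) :
    act A P R.frame (fun s => R.pos s t) (fun s => R.light s t) r =
      (R.newColor A P r t, R.dest A P r t) := rfl

namespace IsExecution

theorem look_mono (hR : R.IsExecution off A P) (r : Fin n) : Monotone (R.look r) :=
  monotone_nat_of_le_succ fun k => by
    linarith [hR.look_lt_compute r k, hR.compute_le_moveStart r k, hR.moveStart_lt_moveEnd r k,
      hR.moveEnd_le_look r k]

theorem moveEnd_mono (hR : R.IsExecution off A P) (r : Fin n) : Monotone (R.moveEnd r) :=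
  monotone_nat_of_le_succ fun k => by
    linarith [hR.look_lt_compute r (k + 1), hR.compute_le_moveStart r (k + 1),
      hR.moveStart_lt_moveEnd r (k + 1), hR.moveEnd_le_look r k]

end IsExecution

namespace QuietFrom

variable {r : Fin n} {k : ℕ} {t : ℝ} {x : Plane} {e : C}

theorem light_look (hR : R.IsExecution off A P) (h : R.QuietFrom A P r k t x e) {t' : ℝ}
    (h1 : t ≤ t') (h2 : t' ≤ R.look r k) : R.light r t' = e :=
  h.light_eq _ h1 (h2.trans_lt (hR.look_lt_compute r k))

theorem pos_look (hR : R.IsExecution off A P) (h : R.QuietFrom A P r k t x e) {t' : ℝ}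
    (h1 : t ≤ t') (h2 : t' ≤ R.look r k) : R.pos r t' = x :=
  h.pos_eq _ h1 (by linarith [hR.look_lt_compute r k, hR.compute_le_moveStart r k])

theorem isStable (hR : R.IsExecution off A P) (h : R.QuietFrom A P r k t x e) :
    R.IsStable A P r t := by
  constructor
  · rintro ⟨i, hne, hi1, hi2⟩
    rcases lt_or_ge i k with hik | hik
    · exact (h.pos_past i hik).elim hne fun h' => by linarith
    · linarith [hR.look_mono r hik, h.le_look, hR.look_lt_compute r i,
        hR.compute_le_moveStart r i]
  · rintro ⟨i, ⟨hne, hi1, hi2⟩ | ⟨hne, hi1, hi2⟩⟩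
    · rcases lt_or_ge i k with hik | hik
      · exact (h.light_past i hik).elim hne fun h' => by linarith
      · linarith [hR.look_mono r hik, h.le_look]
    · rcases lt_or_ge i k with hik | hik
      · refine (h.pos_past i hik).elim hne fun h' => ?_
        linarith [hR.moveStart_lt_moveEnd r i]
      · linarith [hR.look_mono r hik, h.le_look]

/-- Quietness persists up to the next snapshot. -/
theorem mono (h : R.QuietFrom A P r k t x e) {t' : ℝ}
    (h1 : t ≤ t') (h2 : t' ≤ R.look r k) : R.QuietFrom A P r k t' x e where
  le_look := h2
  light_eq u hu := h.light_eq u (h1.trans hu)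
  pos_eq u hu := h.pos_eq u (h1.trans hu)
  light_past i hi := (h.light_past i hi).imp_right fun h' => h'.trans h1
  pos_past i hi := (h.pos_past i hi).imp_right fun h' => h'.trans h1

theorem pos_of_dest_eq (hR : R.IsExecution off A P) (h : R.QuietFrom A P r k t x e)
    (hd : R.dest A P r (R.look r k) = x) {t' : ℝ} (h1 : t ≤ t')
    (h2 : t' ≤ R.moveStart r (k + 1)) : R.pos r t' = x := by
  have hl := h.pos_look hR h.le_look le_rfl
  rcases le_total t' (R.moveStart r k) with h3 | h3
  · exact h.pos_eq _ h1 h3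
  rcases le_total t' (R.moveEnd r k) with h4 | h4
  · obtain ⟨φ, -, -, -, -, hφ⟩ := hR.pos_move r k
    rw [hφ t' ⟨h3, h4⟩, hd, hl, AffineMap.lineMap_same_apply]
  · rw [hR.pos_rest r k t' h4 h2, hd]

/-- A cycle in which the robot decides to stay leaves it quiet. -/
theorem succ (hR : R.IsExecution off A P) (h : R.QuietFrom A P r k t x e)
    (hs : R.newColor A P r (R.look r k) = e ∧ R.dest A P r (R.look r k) = x) :
    R.QuietFrom A P r (k + 1) t x e where
  le_look := h.le_look.trans (hR.look_mono r k.le_succ)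
  light_eq u hu hu' := by
    rcases lt_or_ge u (R.compute r k) with h3 | h3
    · exact h.light_eq u hu h3
    · rw [hR.light_cycle r k u h3 hu', hs.1]
  pos_eq u hu hu' := h.pos_of_dest_eq hR hs.2 hu hu'
  light_past i hi := by
    rcases Nat.lt_succ_iff_lt_or_eq.1 hi with hi | rfl
    · exact h.light_past i hi
    · left; rw [hs.1, h.light_look hR h.le_look le_rfl]
  pos_past i hi := by
    rcases Nat.lt_succ_iff_lt_or_eq.1 hi with hi | rfl
    · exact h.pos_past i hi
    · left; rw [hs.2, h.pos_look hR h.le_look le_rfl]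

/-- A robot stays quiet as long as it decides to stay on every snapshot. -/
theorem extend (hR : R.IsExecution off A P) (h : R.QuietFrom A P r k t x e) {t' : ℝ}
    (ht : t ≤ t') (hs : ∀ i, t ≤ R.look r i → R.look r i < t' → R.light r (R.look r i) = e →
      R.pos r (R.look r i) = x →
      R.newColor A P r (R.look r i) = e ∧ R.dest A P r (R.look r i) = x) :
    ∃ k', R.QuietFrom A P r k' t' x e := by
  have hex : ∃ j, t' ≤ R.look r (k + j) := by
    obtain ⟨j, hj⟩ := ((hR.look_tendsto r).eventually (eventually_ge_atTop t')).exists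
    exact ⟨j, hj.trans (hR.look_mono r (Nat.le_add_left j k))⟩
  have key : ∀ j, (∀ i < j, ¬ t' ≤ R.look r (k + i)) → R.QuietFrom A P r (k + j) t x e := by
    intro j
    induction j with
    | zero => exact fun _ => h
    | succ j ih =>
      intro hj
      have h1 := ih fun i hi => hj i (hi.trans j.lt_succ_self)
      exact h1.succ hR (hs _ h1.le_look (not_le.1 (hj j j.lt_succ_self))
        (h1.light_look hR h1.le_look le_rfl) (h1.pos_look hR h1.le_look le_rfl))
  classical
  refine ⟨k + Nat.find hex, (key _ fun i hi => Nat.find_min hex hi).mono ht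
    (Nat.find_spec hex)⟩

end QuietFrom

/-- If the robots other than `a` decide to stay whenever they have not changed since `t`, then
they do not change: the first snapshot leading to a change would be such a moment. -/
theorem QuietAt.others (hR : R.IsExecution off A P) {t t' : ℝ} (ht : t ≤ t')
    {x : (Fin n → Plane) × (Fin n → C)} (h : R.QuietAt A P t x) (a : Fin n)
    (hs : ∀ u, t ≤ u → u < t' → (∀ s, s ≠ a → R.light s u = x.2 s ∧ R.pos s u = x.1 s) →
      ∀ s, s ≠ a → R.newColor A P s u = x.2 s ∧ R.dest A P s u = x.1 s) :
    ∀ s, s ≠ a → ∃ k, R.QuietFrom A P s k t' (x.1 s) (x.2 s) := by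
  let bad : Set (Fin n × ℕ) := {z | z.1 ≠ a ∧ t ≤ R.look z.1 z.2 ∧ R.look z.1 z.2 < t' ∧
    ¬ (R.newColor A P z.1 (R.look z.1 z.2) = x.2 z.1 ∧
      R.dest A P z.1 (R.look z.1 z.2) = x.1 z.1)}
  have hfin : bad.Finite := by
    have hN : ∀ r, ∃ N, ∀ i, N ≤ i → t' ≤ R.look r i := fun r =>
      eventually_atTop.1 ((hR.look_tendsto r).eventually (eventually_ge_atTop t'))
    choose N hN using hN
    refine (Set.finite_iUnion fun r : Fin n =>
      (Set.finite_singleton r).prod (Set.finite_lt_nat (N r))).subset ?_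
    rintro ⟨r, i⟩ ⟨-, -, hlt, -⟩
    refine mem_iUnion.2 ⟨r, rfl, ?_⟩
    by_contra hi
    exact absurd (hN r i (not_lt.1 hi)) (not_le.2 hlt)
  have hstay : ∀ v, t ≤ v → (∀ z ∈ bad, v ≤ R.look z.1 z.2) → v ≤ t' →
      ∀ s, s ≠ a → ∃ k, R.QuietFrom A P s k v (x.1 s) (x.2 s) := by
    intro v hv hb hv' s hsa
    obtain ⟨k, hk⟩ := h s
    refine hk.extend hR hv fun i h1 h2 _ _ => ?_
    by_contra hcon
    exact absurd (hb (s, i) ⟨hsa, h1, h2.trans_le hv', hcon⟩) (not_le.2 h2)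
  rcases bad.eq_empty_or_nonempty with he | hne
  · exact hstay t' ht (by simp [he]) le_rfl
  · exfalso
    obtain ⟨z, hz, hmin⟩ := hfin.exists_minimalFor (fun z => R.look z.1 z.2) bad hne
    have hmin' : ∀ w ∈ bad, R.look z.1 z.2 ≤ R.look w.1 w.2 := fun w hw =>
      (le_total (R.look z.1 z.2) (R.look w.1 w.2)).elim id fun h' => hmin hw h'
    obtain ⟨hza, hz1, hz2, hz3⟩ := hz
    refine hz3 (hs _ hz1 hz2 (fun s hsa => ?_) _ hza)
    obtain ⟨k, hk⟩ := hstay _ hz1 hmin' hz2.le s hsa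
    exact ⟨hk.light_look hR le_rfl hk.le_look, hk.pos_look hR le_rfl hk.le_look⟩

theorem act_eq_of_config {p : Fin n → Plane} {c : Fin n → C} {t : ℝ}
    (hp : ∀ s, R.pos s t = p s) (hc : ∀ s, R.light s t = c s) (r : Fin n) :
    (R.newColor A P r t, R.dest A P r t) = act A P R.frame p c r := by
  rw [← act_eq, funext hp, funext hc]

/-- Robots that decide to stay leave the configuration unchanged up to the next snapshot of the
robot `a`, provided that only `a` may decide otherwise. -/
theorem QuietAt.next_look (hR : R.IsExecution off A P) {t : ℝ} {p : Fin n → Plane}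
    {c : Fin n → C} (h : R.QuietAt A P t (p, c)) (a : Fin n)
    (ho : ∀ s, s ≠ a → act A P R.frame p c s = (c s, p s)) :
    ∃ k, t ≤ R.look a k ∧ R.QuietFrom A P a k (R.look a k) (p a) (c a) ∧
      (∀ s, ∀ u ∈ Icc t (R.look a k), R.pos s u = p s) ∧ R.QuietAt A P (R.look a k) (p, c) := by
  obtain ⟨k, hk⟩ := h a
  have main : ∀ v, t ≤ v → v ≤ R.look a k → R.QuietAt A P v (p, c) := by
    intro v hv hv' s
    by_cases hsa : s = a
    · subst hsa; exact ⟨k, hk.mono hv hv'⟩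
    refine h.others hR hv a (fun u hu hu' hst s hs => ?_) s hsa
    have hq : ∀ s, R.light s u = c s ∧ R.pos s u = p s := by
      intro s
      by_cases hs : s = a
      · subst hs
        exact ⟨hk.light_look hR hu (hu'.le.trans hv'), hk.pos_look hR hu (hu'.le.trans hv')⟩
      · exact hst s hs
    have := act_eq_of_config (A := A) (P := P) (fun s => (hq s).2) (fun s => (hq s).1) s
    rw [ho s hs] at this
    exact ⟨congrArg Prod.fst this, congrArg Prod.snd this⟩
  refine ⟨k, hk.le_look, hk.mono hk.le_look le_rfl, fun s u hu => ?_,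
    main _ hk.le_look le_rfl⟩
  obtain ⟨j, hj⟩ := main u hu.1 hu.2 s
  exact hj.pos_look hR le_rfl hj.le_look

/-- A solo step is carried out by every execution, without collision. -/
theorem QuietAt.soloStep (hR : R.IsExecution off A P) {t : ℝ}
    {x y : (Fin n → Plane) × (Fin n → C)} (h : R.QuietAt A P t x)
    (hxy : SoloStep A P R.frame x y) (hinj : Function.Injective x.1) :
    ∃ t', t ≤ t' ∧ R.QuietAt A P t' y ∧ Function.Injective y.1 ∧
      ∀ u ∈ Icc t t', Function.Injective fun r => R.pos r u := by
  cases hxy with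
  | recolour p c a e ha ho =>
    obtain ⟨k, htk, hk, hpos, hq⟩ := h.next_look hR a ho
    have hcfg := act_eq_of_config (A := A) (P := P) (R := R) (t := R.look a k) (p := p) (c := c)
      (fun s => (hq s).elim fun j hj => hj.pos_look hR le_rfl hj.le_look)
      (fun s => (hq s).elim fun j hj => hj.light_look hR le_rfl hj.le_look)
    have hd := hcfg a
    rw [ha] at hd
    have hdc : R.newColor A P a (R.look a k) = e := congrArg Prod.fst hd
    have hdp : R.dest A P a (R.look a k) = p a := congrArg Prod.snd hd
    have hlc := hR.look_lt_compute a k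
    have hcs := hR.compute_le_moveStart a k
    have hse := hR.moveStart_lt_moveEnd a k
    have hel := hR.moveEnd_le_look a k
    have main : ∀ v, R.look a k ≤ v → v ≤ R.compute a k → ∀ s, s ≠ a →
        ∃ j, R.QuietFrom A P s j v (p s) (c s) := by
      intro v hv hv'
      refine hq.others hR hv a fun u hu hu' hst s hs => ?_
      have hall : ∀ s, R.light s u = c s ∧ R.pos s u = p s := by
        intro s
        by_cases hs : s = a
        · subst hs
          exact ⟨hk.light_eq _ hu (hu'.trans_le hv'), hk.pos_eq _ hu (by linarith)⟩
        · exact hst s hs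
      have := act_eq_of_config (A := A) (P := P) (fun s => (hall s).2) (fun s => (hall s).1) s
      rw [ho s hs] at this
      exact ⟨congrArg Prod.fst this, congrArg Prod.snd this⟩
    refine ⟨R.compute a k, by linarith, fun s => ?_, hinj, fun u hu => ?_⟩
    · by_cases hs : s = a
      · subst hs
        refine ⟨k + 1, ⟨by linarith, fun u hu hu' => ?_, fun u hu hu' => ?_, fun i hi => ?_,
          fun i hi => ?_⟩⟩
        · rw [hR.light_cycle s k u hu hu', hdc]; simp
        · exact hk.pos_of_dest_eq hR hdp (by linarith) hu'
        · rcases Nat.lt_succ_iff_lt_or_eq.1 hi with hi | rfl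
          · exact (hk.light_past i hi).imp_right fun h' => by linarith
          · exact Or.inr le_rfl
        · rcases Nat.lt_succ_iff_lt_or_eq.1 hi with hi | rfl
          · exact (hk.pos_past i hi).imp_right fun h' => by linarith
          · left; rw [hdp, hk.pos_look hR le_rfl le_rfl]
      · obtain ⟨j, hj⟩ := main _ hlc.le le_rfl s hs
        exact ⟨j, by simpa [hs] using hj⟩
    · have : (fun r => R.pos r u) = p := by
        funext s
        rcases le_total u (R.look a k) with h1 | h1
        · exact hpos s u ⟨hu.1, h1⟩
        by_cases hs : s = a
        · subst hs; exact hk.pos_eq _ h1 (by linarith [hu.2])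
        · obtain ⟨j, hj⟩ := main u h1 hu.2 s hs
          exact hj.pos_look hR le_rfl hj.le_look
      rw [this]; exact hinj
  | move p c a e d ha ho hm =>
    obtain ⟨k, htk, hk, hpos, hq⟩ := h.next_look hR a ho
    have hcfg := act_eq_of_config (A := A) (P := P) (R := R) (t := R.look a k) (p := p) (c := c)
      (fun s => (hq s).elim fun j hj => hj.pos_look hR le_rfl hj.le_look)
      (fun s => (hq s).elim fun j hj => hj.light_look hR le_rfl hj.le_look)
    have hd := hcfg a
    rw [ha] at hd
    have hdc : R.newColor A P a (R.look a k) = e := congrArg Prod.fst hd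
    have hdp : R.dest A P a (R.look a k) = d := congrArg Prod.snd hd
    have hlc := hR.look_lt_compute a k
    have hcs := hR.compute_le_moveStart a k
    have hse := hR.moveStart_lt_moveEnd a k
    have hel := hR.moveEnd_le_look a k
    have hlc' := hR.look_lt_compute a (k + 1)
    have hla := hk.pos_look hR le_rfl le_rfl
    obtain ⟨φ, -, hmono, hφ0, hφ1, hφ⟩ := hR.pos_move a k
    rw [hla, hdp] at hφ
    have hmem : ∀ u ∈ Icc (R.moveStart a k) (R.moveEnd a k), φ u ∈ Icc (0 : ℝ) 1 := fun u hu =>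
      ⟨hφ0 ▸ hmono (left_mem_Icc.2 hse.le) hu hu.1, hφ1 ▸ hmono hu (right_mem_Icc.2 hse.le) hu.2⟩
    -- the position of the moving robot from its snapshot to the end of its movement
    have hline : ∀ u, R.look a k ≤ u → u ≤ R.moveEnd a k → ∃ l ∈ Icc (0 : ℝ) 1,
        R.pos a u = AffineMap.lineMap (p a) d l := by
      intro u hu hu'
      rcases le_total u (R.moveStart a k) with h1 | h1
      · exact ⟨0, by simp, by rw [hk.pos_eq u hu h1, AffineMap.lineMap_apply_zero]⟩
      · exact ⟨φ u, hmem u ⟨h1, hu'⟩, hφ u ⟨h1, hu'⟩⟩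
    have main : ∀ v, R.look a k ≤ v → v ≤ R.moveEnd a k → ∀ s, s ≠ a →
        ∃ j, R.QuietFrom A P s j v (p s) (c s) := by
      intro v hv hv'
      refine hq.others hR hv a fun u hu hu' hst s hs => ?_
      rcases lt_or_ge u (R.compute a k) with h1 | h1
      · have hall : ∀ s, R.light s u = c s ∧ R.pos s u = p s := by
          intro s
          by_cases hs : s = a
          · subst hs
            exact ⟨hk.light_eq _ hu h1, hk.pos_eq _ hu (by linarith)⟩
          · exact hst s hs
        have := act_eq_of_config (A := A) (P := P) (fun s => (hall s).2)
          (fun s => (hall s).1) s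
        rw [ho s hs] at this
        exact ⟨congrArg Prod.fst this, congrArg Prod.snd this⟩
      · obtain ⟨l, hl, hul⟩ := hline u hu (hu'.le.trans hv')
        have := act_eq_of_config (A := A) (P := P) (R := R) (t := u)
          (p := Function.update p a (AffineMap.lineMap (p a) d l))
          (c := Function.update c a e) (fun s => ?_) (fun s => ?_) s
        · rw [(hm l hl).2 s hs] at this
          exact ⟨congrArg Prod.fst this, congrArg Prod.snd this⟩
        · by_cases hs : s = a
          · subst hs; simp [hul]
          · simp [hs, (hst s hs).2]
        · by_cases hs : s = a
          · subst hs
            rw [hR.light_cycle s k u h1 (by linarith), hdc]; simp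
          · simp [hs, (hst s hs).1]
    refine ⟨R.moveEnd a k, by linarith, fun s => ?_, ?_, fun u hu => ?_⟩
    · by_cases hs : s = a
      · subst hs
        refine ⟨k + 1, ⟨hel, fun u hu hu' => ?_, fun u hu hu' => ?_, fun i hi => ?_,
          fun i hi => ?_⟩⟩
        · rw [hR.light_cycle s k u (by linarith) hu', hdc]; simp
        · rw [hR.pos_rest s k u hu hu', hdp]; simp
        · refine Or.inr ?_
          linarith [hR.moveEnd_mono s (Nat.lt_succ_iff.1 hi), hR.compute_le_moveStart s i,
            hR.moveStart_lt_moveEnd s i]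
        · exact Or.inr (hR.moveEnd_mono s (Nat.lt_succ_iff.1 hi))
      · obtain ⟨j, hj⟩ := main _ (by linarith) le_rfl s hs
        exact ⟨j, by simpa [hs] using hj⟩
    · simpa using (hm 1 (by simp)).1
    · rcases le_total u (R.look a k) with h1 | h1
      · have : (fun r => R.pos r u) = p := funext fun s => hpos s u ⟨hu.1, h1⟩
        rw [this]; exact hinj
      · obtain ⟨l, hl, hul⟩ := hline u h1 hu.2
        have : (fun r => R.pos r u) = Function.update p a (AffineMap.lineMap (p a) d l) := by
          funext s
          by_cases hs : s = a
          · subst hs; simp [hul]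
          · obtain ⟨j, hj⟩ := main u h1 hu.2 s hs
            simp [hs, hj.pos_look hR le_rfl hj.le_look]
        rw [this]; exact (hm l hl).1

theorem QuietAt.reflTransGen (hR : R.IsExecution off A P) {t : ℝ}
    {x y : (Fin n → Plane) × (Fin n → C)} (h : R.QuietAt A P t x)
    (hxy : Relation.ReflTransGen (SoloStep A P R.frame) x y) (hinj : Function.Injective x.1) :
    ∃ t', t ≤ t' ∧ R.QuietAt A P t' y ∧ Function.Injective y.1 ∧
      ∀ u ∈ Icc t t', Function.Injective fun r => R.pos r u := by
  induction hxy with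
  | refl =>
    refine ⟨t, le_rfl, h, hinj, fun u hu => ?_⟩
    have : (fun r => R.pos r u) = x.1 := funext fun r => by
      obtain ⟨k, hk⟩ := h r
      rw [le_antisymm hu.2 hu.1, hk.pos_look hR le_rfl hk.le_look]
    rw [this]; exact hinj
  | tail _ hst ih =>
    obtain ⟨t1, h1, hq, hi, hu1⟩ := ih
    obtain ⟨t2, h2, hq2, hi2, hu2⟩ := hq.soloStep hR hst hi
    refine ⟨t2, h1.trans h2, hq2, hi2, fun u hu => ?_⟩
    rcases le_total u t1 with h3 | h3
    · exact hu1 u ⟨hu.1, h3⟩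
    · exact hu2 u ⟨h3, hu.2⟩

theorem IsExecution.quietAt_zero (hR : R.IsExecution off A P) :
    R.QuietAt A P 0 (fun r => R.pos r 0, fun _ => off) := fun r =>
  ⟨0, hR.look_nonneg r, fun u hu hu' => hR.light_init r u hu hu',
    fun u hu hu' => hR.pos_init r u hu hu', fun i hi => absurd hi i.not_lt_zero,
    fun i hi => absurd hi i.not_lt_zero⟩

/-- To achieve arbitrary pattern formation it suffices to reach, by solo steps, a monochromatic
configuration that forms the pattern and in which every robot decides to stay. -/
theorem IsExecution.achievesAPF (hR : R.IsExecution off A P)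
    (hinj : Function.Injective fun r => R.pos r 0) {p : Fin n → Plane} {e : C}
    (hreach : Relation.ReflTransGen (SoloStep A P R.frame)
      (fun r => R.pos r 0, fun _ => off) (p, fun _ => e))
    (hstay : ∀ r, act A P R.frame p (fun _ => e) r = (e, p r)) (hform : FormsPattern p P) :
    AchievesAPF R A P := by
  obtain ⟨t, ht, hq, -, hu⟩ := hR.quietAt_zero.reflTransGen hR hreach hinj
  have hp : ∀ r, R.pos r t = p r := fun r => by
    obtain ⟨k, hk⟩ := hq r
    exact hk.pos_look hR le_rfl hk.le_look
  have hc : ∀ r, R.light r t = e := fun r => by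
    obtain ⟨k, hk⟩ := hq r
    exact hk.light_look hR le_rfl hk.le_look
  refine ⟨t, ht, ⟨fun r => ?_, fun r => ?_⟩, ⟨e, hc⟩, ?_, hu⟩
  · obtain ⟨k, hk⟩ := hq r
    exact hk.isStable hR
  · have := act_eq_of_config (A := A) (P := P) hp hc r
    rw [hstay r] at this
    exact ⟨(congrArg Prod.fst this).trans (hc r).symm, (congrArg Prod.snd this).trans (hp r).symm⟩
  · rwa [funext hp]

end Run

/-! ### Removal of the common axes -/

/-- The frame with the same unit whose axes are those of the ambient plane. -/
def Frame.standard (F : Frame) : Frame := ⟨F.unit, F.unit_pos, LinearIsometryEquiv.refl ℝ Plane⟩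

theorem visible_map_iff {n : ℕ} (L : Plane ≃ₗᵢ[ℝ] Plane) (p : Fin n → Plane) (r s : Fin n) :
    Visible (fun u => L (p u)) r s ↔ Visible p r s := by
  have h : ∀ u, L (p u) ∈ segment ℝ (L (p r)) (L (p s)) ↔ p u ∈ segment ℝ (p r) (p s) := by
    intro u
    have := image_segment ℝ (L.toLinearEquiv : Plane →ₗ[ℝ] Plane).toAffineMap (p r) (p s)
    have h2 : segment ℝ (L (p r)) (L (p s)) = L '' segment ℝ (p r) (p s) := this.symm
    rw [h2, L.injective.mem_set_image]
  simp only [Visible, h]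

/-- A robot with axes `L` sees and does the same as a robot with standard axes in the
configuration rotated by `L`. -/
theorem act_map {n : ℕ} {C : Type} (A : Algorithm C) (P : Fin n → Plane) {F : Fin n → Frame}
    {L : Plane ≃ₗᵢ[ℝ] Plane} (hF : ∀ r, (F r).axes = L) (p : Fin n → Plane) (c : Fin n → C)
    (r : Fin n) :
    act A P (fun s => (F s).standard) (fun s => L (p s)) c r =
      ((act A P F p c r).1, L (act A P F p c r).2) := by
  have h : snapshot (F r).standard (fun s => L (p s)) c r = snapshot (F r) p c r := by
    simp [snapshot, visible_map_iff, Frame.toLocal, Frame.standard, hF]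
  simp only [act, h]
  simp [Frame.toGlobal, Frame.standard, hF]
  rfl

theorem SoloStep.of_map {n : ℕ} {C : Type} {A : Algorithm C} {P : Fin n → Plane}
    {F : Fin n → Frame} {L : Plane ≃ₗᵢ[ℝ] Plane} (hF : ∀ r, (F r).axes = L)
    {x y : (Fin n → Plane) × (Fin n → C)}
    (h : SoloStep A P (fun s => (F s).standard) x y) :
    SoloStep A P F (fun s => L.symm (x.1 s), x.2) (fun s => L.symm (y.1 s), y.2) := by
  have hact : ∀ (p : Fin n → Plane) (c : Fin n → C) (r : Fin n) (e : C) (d : Plane),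
      act A P (fun s => (F s).standard) p c r = (e, d) →
      act A P F (fun s => L.symm (p s)) c r = (e, L.symm d) := by
    intro p c r e d h
    have := act_map A P hF (fun s => L.symm (p s)) c r
    simp only [LinearIsometryEquiv.apply_symm_apply] at this
    rw [h] at this
    refine Prod.ext (congrArg Prod.fst this).symm ?_
    rw [LinearIsometryEquiv.eq_symm_apply]
    exact (congrArg Prod.snd this).symm
  have hupd : ∀ (p : Fin n → Plane) (a : Fin n) (d : Plane),
      (fun s => L.symm (Function.update p a d s)) =
        Function.update (fun s => L.symm (p s)) a (L.symm d) := by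
    intro p a d
    funext s
    by_cases hs : s = a
    · subst hs; simp
    · simp [hs]
  cases h with
  | recolour p c a e h ho =>
    exact .recolour _ _ a e (hact _ _ _ _ _ h) fun s hs => hact _ _ _ _ _ (ho s hs)
  | move p c a e d h ho hm =>
    simp only [hupd]
    refine .move _ _ a e _ (hact _ _ _ _ _ h) (fun s hs => hact _ _ _ _ _ (ho s hs)) ?_
    intro φ hφ
    have hl : AffineMap.lineMap (L.symm (p a)) (L.symm d) φ =
        L.symm (AffineMap.lineMap (p a) d φ) := by
      simp [AffineMap.lineMap_apply]
    obtain ⟨h1, h2⟩ := hm φ hφ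
    rw [hl, ← hupd]
    refine ⟨L.symm.injective.comp h1, fun s hs => ?_⟩
    rw [hact _ _ _ _ _ (h2 s hs)]

/-! ### The lexicographic order of the plane -/

/-- The lexicographic order of the plane: by the second coordinate (the height), then by the
first. -/
def key (x : Plane) : ℝ ×ₗ ℝ := toLex (x 1, x 0)

theorem key_lt_iff {x y : Plane} : key x < key y ↔ x 1 < y 1 ∨ x 1 = y 1 ∧ x 0 < y 0 :=
  Prod.Lex.toLex_lt_toLex

theorem key_injective : Function.Injective key := by
  intro x y h
  have h' : (x 1, x 0) = (y 1, y 0) := toLex.injective h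
  simp only [Prod.mk.injEq] at h'
  ext i
  fin_cases i
  · exact h'.2
  · exact h'.1

theorem le_of_key_le {x y : Plane} (h : key x ≤ key y) : x 1 ≤ y 1 := by
  by_contra hlt
  exact absurd h (not_le.2 (key_lt_iff.2 (Or.inl (not_le.1 hlt))))

theorem key_add_smul_lt_iff {s : ℝ} (hs : 0 < s) (T x y : Plane) :
    key (T + s • x) < key (T + s • y) ↔ key x < key y := by
  simp [key_lt_iff, hs, hs.ne']

theorem key_smul_sub_lt_iff {s : ℝ} (hs : 0 < s) (o x y : Plane) :
    key (s • (x - o)) < key (s • (y - o)) ↔ key x < key y := by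
  simp [key_lt_iff, hs, hs.ne']

theorem key_zero_lt_iff {s : ℝ} (hs : 0 < s) (o x : Plane) :
    key 0 < key (s • (x - o)) ↔ key o < key x := by
  simpa using key_smul_sub_lt_iff hs o o x

theorem key_lt_zero_iff {s : ℝ} (hs : 0 < s) (o x : Plane) :
    key (s • (x - o)) < key 0 ↔ key x < key o := by
  simpa using key_smul_sub_lt_iff hs o x o

theorem lineMap_coord (x y : Plane) (φ : ℝ) (i : Fin 2) :
    (AffineMap.lineMap x y φ : Plane) i = (1 - φ) * x i + φ * y i := by
  simp [AffineMap.lineMap_apply]; ring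

theorem key_neg_lt_iff {x y : Plane} : key (-x) < key (-y) ↔ key y < key x := by
  simp [key_lt_iff, eq_comm]

theorem lt_key_lineMap {l : ℝ ×ₗ ℝ} {x y : Plane} {φ : ℝ} (hφ : φ ∈ Icc (0 : ℝ) 1) (hx : l < key x)
    (hy : l < key y) : l < key (AffineMap.lineMap x y φ) := by
  obtain ⟨z, rfl⟩ : ∃ z, key z = l := ⟨!₂[(ofLex l).2, (ofLex l).1], by simp [key]⟩
  have conv : ∀ a b c : ℝ, a < b → a < c → a < (1 - φ) * b + φ * c := fun a b c hb hc =>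
    convex_Ioi a hb hc (by linarith [hφ.2]) hφ.1 (by ring)
  rw [key_lt_iff] at hx hy ⊢
  rw [lineMap_coord, lineMap_coord]
  rcases hφ.1.eq_or_lt with rfl | h0
  · simpa using hx
  rcases hφ.2.eq_or_lt with rfl | h1
  · simpa using hy
  rcases hx with hx | ⟨hx, hx'⟩ <;> rcases hy with hy | ⟨hy, hy'⟩
  · exact Or.inl (conv _ _ _ hx hy)
  · left; rw [← hy]; nlinarith
  · left; rw [← hx]; nlinarith
  · right; rw [← hx, ← hy]; exact ⟨by ring, conv _ _ _ hx' hy'⟩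

theorem key_lineMap_lt {l : Plane} {x y : Plane} {φ : ℝ} (hφ : φ ∈ Icc (0 : ℝ) 1)
    (hx : key x < key l) (hy : key y < key l) : key (AffineMap.lineMap x y φ) < key l := by
  rw [← key_neg_lt_iff] at hx hy ⊢
  have : -(AffineMap.lineMap x y φ : Plane) = AffineMap.lineMap (-x) (-y) φ := by
    ext i; simp only [PiLp.neg_apply, lineMap_coord]; ring
  rw [this]
  exact lt_key_lineMap hφ hx hy

theorem key_lineMap_mem_Ioo {x y : Plane} {φ : ℝ} (h0 : 0 < φ) (h1 : φ < 1)
    (h : key x < key y) : key (AffineMap.lineMap x y φ) ∈ Ioo (key x) (key y) := by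
  have h1' : 0 < 1 - φ := by linarith
  simp only [mem_Ioo, key_lt_iff, lineMap_coord] at h ⊢
  rcases h with h | ⟨h, h'⟩
  · exact ⟨Or.inl (by nlinarith), Or.inl (by nlinarith)⟩
  · rw [h]
    exact ⟨Or.inr ⟨by ring, by nlinarith⟩, Or.inr ⟨by ring, by nlinarith⟩⟩

/-! ### Visibility between lexicographic neighbours -/

section Neighbours

variable {n : ℕ} {p : Fin n → Plane}

theorem visible_symm {r s : Fin n} (h : Visible p r s) : Visible p s r := fun u hs hr => by
  rw [segment_symm]; exact h u hr hs

/-- Robots that are adjacent in the lexicographic order see each other, because a robot on the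
segment joining them would be lexicographically between them. -/
theorem visible_of_adjacent (hp : Function.Injective p) {r s : Fin n}
    (hrs : key (p r) < key (p s))
    (h : ∀ u, ¬ (key (p r) < key (p u) ∧ key (p u) < key (p s))) : Visible p r s := by
  intro u hur hus hmem
  rw [segment_eq_image_lineMap] at hmem
  obtain ⟨φ, hφ, hu⟩ := hmem
  have h0 : φ ≠ 0 := by
    rintro rfl
    exact hur (hp (by simpa using hu.symm))
  have h1 : φ ≠ 1 := by
    rintro rfl
    exact hus (hp (by simpa using hu.symm))
  apply h u
  rw [← hu]
  exact key_lineMap_mem_Ioo (lt_of_le_of_ne hφ.1 h0.symm) (lt_of_le_of_ne hφ.2 h1) hrs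

theorem exists_visible_succ (hp : Function.Injective p) {r : Fin n}
    (h : ∃ s, key (p r) < key (p s)) :
    ∃ s, key (p r) < key (p s) ∧ Visible p r s ∧
      ∀ u, key (p r) < key (p u) → key (p s) ≤ key (p u) := by
  classical
  obtain ⟨s, hs, hmin⟩ := Finset.exists_min_image
    (Finset.univ.filter fun s => key (p r) < key (p s)) (fun s => key (p s))
    (by simpa [Finset.Nonempty] using h)
  simp only [Finset.mem_filter, Finset.mem_univ, true_and] at hs hmin
  exact ⟨s, hs, visible_of_adjacent hp hs fun u hu => not_lt.2 (hmin u hu.1) hu.2, hmin⟩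

theorem exists_visible_pred (hp : Function.Injective p) {r : Fin n}
    (h : ∃ s, key (p s) < key (p r)) :
    ∃ s, key (p s) < key (p r) ∧ Visible p r s ∧
      ∀ u, key (p u) < key (p r) → key (p u) ≤ key (p s) := by
  classical
  obtain ⟨s, hs, hmax⟩ := Finset.exists_max_image
    (Finset.univ.filter fun s => key (p s) < key (p r)) (fun s => key (p s))
    (by simpa [Finset.Nonempty] using h)
  simp only [Finset.mem_filter, Finset.mem_univ, true_and] at hs hmax
  exact ⟨s, hs, visible_symm (visible_of_adjacent hp hs fun u hu => not_lt.2 (hmax u hu.2) hu.1),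
    hmax⟩

/-- A robot shifted horizontally by different multiples of a nonzero length, while no other
robot is at its height, sees all other robots from one of the resulting positions: each line
through two other robots obstructs the view from at most one of them. -/
theorem exists_shift_visible (hp : Function.Injective p) (a : Fin n)
    (hlev : ∀ s, s ≠ a → (p s) 1 ≠ (p a) 1) {l : ℝ} (hl : l ≠ 0) :
    ∃ i : ℕ, ∀ s, s ≠ a →
      Visible (Function.update p a (p a + ((i : ℝ) * l) • EuclideanSpace.single 0 (1 : ℝ))) a s := by
  classical
  by_contra! hcon
  simp only [Visible, not_forall, not_not] at hcon
  choose s hsa u hua hus hmem using hcon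
  obtain ⟨i, j, hij, heq⟩ := Finite.exists_ne_map_eq_of_infinite fun i => (s i, u i)
  simp only [Prod.mk.injEq] at heq
  have hi := hmem i
  have hj := hmem j
  have hsu : p (u j) ≠ p (s j) := fun h => hus j (hp h)
  rw [heq.1, heq.2] at hi
  simp only [Function.update_self, Function.update_of_ne (hsa j), Function.update_of_ne (hua j),
    segment_eq_image_lineMap, mem_image] at hi hj
  obtain ⟨φ, -, hφ⟩ := hi
  obtain ⟨ψ, -, hψ⟩ := hj
  have h1 := congrArg (fun x : Plane => x 1) hφ
  have h2 := congrArg (fun x : Plane => x 1) hψ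
  have h3 := congrArg (fun x : Plane => x 0) hφ
  have h4 := congrArg (fun x : Plane => x 0) hψ
  simp only [lineMap_coord] at h1 h2 h3 h4
  simp at h1 h2 h3 h4
  have hne : (p (s j)) 1 - (p a) 1 ≠ 0 := sub_ne_zero.2 (hlev _ (hsa j))
  have hφψ : φ = ψ := mul_right_cancel₀ hne (by linarith)
  subst hφψ
  have h5 : (1 - φ) * (((i : ℝ) - j) * l) = 0 := by linarith
  rcases mul_eq_zero.1 h5 with h6 | h6
  · obtain rfl : φ = 1 := by linarith
    exact hsu (by simpa using hψ.symm)
  · rcases mul_eq_zero.1 h6 with h7 | h7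
    · exact hij (by exact_mod_cast sub_eq_zero.1 h7)
    · exact hl h7

end Neighbours

/-! ### The algorithm -/

/-- The visible positions `V`, in local coordinates, are compatible with the copy
`T + s • P` of the pattern: the robots above the observer occupy exactly the points of the copy
above `T + s • P q`, and the robots below the observer are lower than the whole copy. -/
structure Fits {n : ℕ} (P : Fin n → Plane) (V : Set Plane) (s : ℝ) (T : Plane) (q : Fin n) :
    Prop where
  pos : 0 < s
  above : {z ∈ V | key 0 < key z} = (fun j => T + s • P j) '' {j | key (P q) < key (P j)}
  below : ∀ z ∈ V, key z < key 0 → ∀ j, z 1 < (T + s • P j) 1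

open Classical in
/-- The highest free point of a copy of the pattern that is compatible with `V`. -/
def target {n : ℕ} (P : Fin n → Plane) (V : Set Plane) : Plane :=
  if h : ∃ x : ℝ × Plane × Fin n, Fits P V x.1 x.2.1 x.2.2 then
    h.choose.2.1 + h.choose.1 • P h.choose.2.2
  else 0

open Classical in
/-- A positive height that is lower than all points of `V` above the observer. -/
def climb (V : Set Plane) : ℝ :=
  if h : ∃ y : ℝ, 0 < y ∧ ∀ z ∈ V, key 0 < key z → y < z 1 then h.choose else 0

open Classical in
/-- The colours `0`, `1`, `2` mean "not placed", "moving to the pattern" and "placed". A robot of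
colour `0` acts if all robots that it sees above itself are placed. It first gets rid of robots
at its own height by climbing, then shifts to the right until it sees all other robots, and
then goes to its point of the pattern. -/
def algorithm : Algorithm (Fin 3) := fun n P c V =>
  if c = 0 ∧ ∀ z ∈ V, key 0 < key z.1 → z.2 = 2 then
    if ∃ z ∈ V, z.1 1 = 0 then (0, climb (Prod.fst '' V) • EuclideanSpace.single 1 1)
    else if V.ncard + 1 = n then (1, target P (Prod.fst '' V))
    else (0, EuclideanSpace.single 0 1)
  else (if c = 1 then 2 else c, 0)

section Act

variable {n : ℕ} {P : Fin n → Plane} {F : Fin n → Frame} {p : Fin n → Plane} {c : Fin n → Fin 3}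
  {a : Fin n}

theorem toLocal_eq (hF : ∀ r, (F r).axes = LinearIsometryEquiv.refl ℝ Plane) (r : Fin n)
    (o x : Plane) : (F r).toLocal o x = (F r).unit⁻¹ • (x - o) := by
  simp [Frame.toLocal, hF]

theorem toGlobal_eq (hF : ∀ r, (F r).axes = LinearIsometryEquiv.refl ℝ Plane) (r : Fin n)
    (o y : Plane) : (F r).toGlobal o y = o + (F r).unit • y := by
  simp only [Frame.toGlobal, hF]
  rfl

theorem toGlobal_zero (F : Frame) (o : Plane) : F.toGlobal o 0 = o := by
  simp [Frame.toGlobal]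

theorem act_eq_of_two (h : c a = 2) : act algorithm P F p c a = (2, p a) := by
  simp [act, algorithm, h, toGlobal_zero]

theorem act_eq_of_one (h : c a = 1) : act algorithm P F p c a = (2, p a) := by
  simp [act, algorithm, h, toGlobal_zero]

/-- A robot of colour `0` waits if some robot `b` above it is not placed, nor is any robot
between them: then its lexicographic successor, which it sees, is not placed. -/
theorem act_eq_of_waiting (hF : ∀ r, (F r).axes = LinearIsometryEquiv.refl ℝ Plane)
    (hp : Function.Injective p) (h : c a = 0) {b : Fin n} (hb : key (p a) < key (p b))
    (hc : ∀ s, key (p a) < key (p s) → key (p s) ≤ key (p b) → c s ≠ 2) :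
    act algorithm P F p c a = (0, p a) := by
  have hcond : ¬ (c a = 0 ∧ ∀ z ∈ snapshot (F a) p c a, key 0 < key z.1 → z.2 = 2) := by
    rintro ⟨-, hz⟩
    obtain ⟨s, hs, hv, hmin⟩ := exists_visible_succ hp ⟨b, hb⟩
    refine hc s hs (hmin b hb) (hz _ ⟨s, ?_, hv, rfl⟩ ?_)
    · rintro rfl; exact lt_irrefl _ hs
    · rwa [toLocal_eq hF, key_zero_lt_iff (inv_pos.2 (F a).unit_pos)]
  simp only [act, algorithm, if_neg hcond, toGlobal_zero, h]
  simp

theorem mem_fst_snapshot {z : Plane} :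
    z ∈ Prod.fst '' snapshot (F a) p c a ↔
      ∃ s, s ≠ a ∧ Visible p a s ∧ z = (F a).toLocal (p a) (p s) := by
  simp only [snapshot, mem_image, mem_ofPred_eq]
  constructor
  · rintro ⟨_, ⟨s, h1, h2, rfl⟩, rfl⟩
    exact ⟨s, h1, h2, rfl⟩
  · rintro ⟨s, h1, h2, rfl⟩
    exact ⟨_, ⟨s, h1, h2, rfl⟩, rfl⟩

theorem forall_mem_snapshot (hF : ∀ r, (F r).axes = LinearIsometryEquiv.refl ℝ Plane)
    (hc : ∀ s, key (p a) < key (p s) → c s = 2) :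
    ∀ z ∈ snapshot (F a) p c a, key 0 < key z.1 → z.2 = 2 := by
  rintro _ ⟨s, -, -, rfl⟩ hs
  rw [toLocal_eq hF, key_zero_lt_iff (inv_pos.2 (F a).unit_pos)] at hs
  exact hc s hs

theorem exists_mem_snapshot_level (hF : ∀ r, (F r).axes = LinearIsometryEquiv.refl ℝ Plane) :
    (∃ z ∈ snapshot (F a) p c a, z.1 1 = 0) ↔
      ∃ s, s ≠ a ∧ Visible p a s ∧ (p s) 1 = (p a) 1 := by
  have hu := (F a).unit_pos.ne'
  constructor
  · rintro ⟨_, ⟨s, h1, h2, rfl⟩, h3⟩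
    refine ⟨s, h1, h2, ?_⟩
    simpa [toLocal_eq hF, hu, sub_eq_zero] using h3
  · rintro ⟨s, h1, h2, h3⟩
    exact ⟨_, ⟨s, h1, h2, rfl⟩, by simp [toLocal_eq hF, h3]⟩

/-- Since the number of robots is known, a robot can tell whether it sees all of them. -/
theorem ncard_snapshot_iff (hF : ∀ r, (F r).axes = LinearIsometryEquiv.refl ℝ Plane)
    (hp : Function.Injective p) :
    (snapshot (F a) p c a).ncard + 1 = n ↔ ∀ s, s ≠ a → Visible p a s := by
  have himg : snapshot (F a) p c a =
      (fun s => ((F a).toLocal (p a) (p s), c s)) '' {s | s ≠ a ∧ Visible p a s} := by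
    ext z
    simp only [snapshot, mem_ofPred_eq, mem_image]
    constructor
    · rintro ⟨s, h1, h2, rfl⟩; exact ⟨s, ⟨h1, h2⟩, rfl⟩
    · rintro ⟨s, ⟨h1, h2⟩, rfl⟩; exact ⟨s, h1, h2, rfl⟩
  have hinj : Function.Injective fun s => ((F a).toLocal (p a) (p s), c s) := by
    intro s t hst
    have h1 := congrArg Prod.fst hst
    simp only [toLocal_eq hF] at h1
    exact hp (sub_left_injective (smul_right_injective _ (inv_pos.2 (F a).unit_pos).ne' h1))
  have hsub : {s | s ≠ a ∧ Visible p a s} ⊆ ({a}ᶜ : Set (Fin n)) := fun s hs => hs.1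
  have hcard : ({a}ᶜ : Set (Fin n)).ncard + 1 = n := by
    have := Set.ncard_add_ncard_compl ({a} : Set (Fin n))
    simp only [Set.ncard_singleton, Nat.card_eq_fintype_card, Fintype.card_fin] at this
    omega
  rw [himg, Set.ncard_image_of_injective _ hinj]
  constructor
  · intro h s hs
    have heq := Set.eq_of_subset_of_ncard_le hsub (by omega)
    exact (heq.symm.subset hs : _ ∧ _).2
  · intro h
    rw [hsub.antisymm fun s hs => ⟨hs, h s hs⟩, hcard]

/-! ### One robot taking its place -/

/-- The robots in `D` are placed on the points of the copy `T + s • P` of the pattern above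
`T + s • P q`, the robot `a` is the next one to be placed, and the remaining robots are below
`a` and lower than the copy. -/
structure Stage (P p : Fin n → Plane) (c : Fin n → Fin 3) (a : Fin n) (D : Set (Fin n)) (s : ℝ)
    (T : Plane) (q : Fin n) : Prop where
  inj : Function.Injective p
  notMem : a ∉ D
  colour_of_mem : ∀ r ∈ D, c r = 2
  colour_of_notMem : ∀ r ∉ D, c r = 0
  above : ∀ r ∈ D, (p a) 1 < (p r) 1
  below : ∀ r ∉ D, r ≠ a → key (p r) < key (p a)
  pos : 0 < s
  image : p '' D = (fun j => T + s • P j) '' {j | key (P q) < key (P j)}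
  low : ∀ r ∉ D, r ≠ a → ∀ j, (p r) 1 < (T + s • P j) 1

variable {D : Set (Fin n)} {s : ℝ} {T : Plane} {q : Fin n}

/-- As long as `a` is between the placed robots and the others, and is not placed, all other
robots stay. -/
theorem act_eq_of_between (hF : ∀ r, (F r).axes = LinearIsometryEquiv.refl ℝ Plane)
    (hp : Function.Injective p) (hD : ∀ r ∈ D, c r = 2) (hD' : ∀ r ∉ D, r ≠ a → c r = 0)
    (ha : c a ≠ 2) (hgt : ∀ r ∈ D, key (p a) < key (p r))
    (hlt : ∀ r ∉ D, r ≠ a → key (p r) < key (p a)) (r : Fin n) (hr : r ≠ a) :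
    act algorithm P F p c r = (c r, p r) := by
  by_cases hrD : r ∈ D
  · rw [act_eq_of_two (hD r hrD), hD r hrD]
  · rw [act_eq_of_waiting hF hp (hD' r hrD hr) (hlt r hrD hr), hD' r hrD hr]
    intro t _ hta
    by_cases ht : t = a
    · rwa [ht]
    · have htD : t ∉ D := fun htD => absurd hta (not_le.2 (hgt t htD))
      simp [hD' t htD ht]

theorem injective_update_of_ne (hp : Function.Injective p) {x : Plane}
    (hx : ∀ r, r ≠ a → p r ≠ x) : Function.Injective (Function.update p a x) := by
  intro r t h
  by_cases hr : r = a <;> by_cases ht : t = a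
  · rw [hr, ht]
  · subst hr; simp [ht] at h; exact absurd h.symm (hx t ht)
  · subst ht; simp [hr] at h; exact absurd h (hx r hr)
  · simp [hr, ht] at h; exact hp h

namespace Stage

theorem key_above (h : Stage P p c a D s T q) : ∀ r ∈ D, key (p a) < key (p r) := fun r hr =>
  key_lt_iff.2 (Or.inl (h.above r hr))

theorem key_lt_iff_mem (h : Stage P p c a D s T q) (r : Fin n) :
    key (p a) < key (p r) ↔ r ∈ D := by
  refine ⟨fun hr => ?_, h.key_above r⟩
  by_contra hrD
  by_cases hra : r = a
  · subst hra; exact lt_irrefl _ hr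
  · exact lt_asymm hr (h.below r hrD hra)

theorem turn (hF : ∀ r, (F r).axes = LinearIsometryEquiv.refl ℝ Plane)
    (h : Stage P p c a D s T q) :
    c a = 0 ∧ ∀ z ∈ snapshot (F a) p c a, key 0 < key z.1 → z.2 = 2 :=
  ⟨h.colour_of_notMem a h.notMem,
    forall_mem_snapshot hF fun r hr => h.colour_of_mem r ((h.key_lt_iff_mem r).1 hr)⟩

theorem injective_update (h : Stage P p c a D s T q) {d : Plane}
    (hgt : ∀ r ∈ D, key d < key (p r)) (hlt : ∀ r ∉ D, r ≠ a → key (p r) < key d) :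
    Function.Injective (Function.update p a d) := by
  refine injective_update_of_ne h.inj fun r hr hrd => ?_
  subst hrd
  by_cases hrD : r ∈ D
  · exact lt_irrefl _ (hgt r hrD)
  · exact lt_irrefl _ (hlt r hrD hr)

/-- A movement of `a` within the gap between the placed robots and the others is a solo step,
because lexicographic intervals are convex. -/
theorem soloStep (hF : ∀ r, (F r).axes = LinearIsometryEquiv.refl ℝ Plane)
    (h : Stage P p c a D s T q) {e : Fin 3} {d : Plane}
    (ha : act algorithm P F p c a = (e, d)) (he : e ≠ 2) (hgt : ∀ r ∈ D, key d < key (p r))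
    (hlt : ∀ r ∉ D, r ≠ a → key (p r) < key d) :
    SoloStep algorithm P F (p, c) (Function.update p a d, Function.update c a e) := by
  have hne : ∀ r ∈ D, r ≠ a := fun r hr hra => h.notMem (hra ▸ hr)
  refine .move p c a e d ha (act_eq_of_between hF h.inj h.colour_of_mem
    (fun r hr _ => h.colour_of_notMem r hr) (by simp [h.colour_of_notMem a h.notMem])
    h.key_above h.below) fun φ hφ => ?_
  have hgt' : ∀ r ∈ D, key (AffineMap.lineMap (p a) d φ) < key (p r) := fun r hr =>
    key_lineMap_lt hφ (h.key_above r hr) (hgt r hr)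
  have hlt' : ∀ r ∉ D, r ≠ a → key (p r) < key (AffineMap.lineMap (p a) d φ) := fun r hr hra =>
    lt_key_lineMap hφ (h.below r hr hra) (hlt r hr hra)
  have hinj := h.injective_update hgt' hlt'
  refine ⟨hinj, fun r hr => ?_⟩
  have := act_eq_of_between (P := P) (D := D) (a := a) (c := Function.update c a e) hF hinj
    (fun r hr => by simp [hne r hr, h.colour_of_mem r hr])
    (fun r hr hra => by simp [hra, h.colour_of_notMem r hr]) (by simpa using he)
    (fun r hr => by simpa [hne r hr] using hgt' r hr)
    (fun r hr hra => by simpa [hra] using hlt' r hr hra) r hr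
  simpa [hr] using this

theorem update (h : Stage P p c a D s T q) {d : Plane} (hgt : ∀ r ∈ D, d 1 < (p r) 1)
    (hlt : ∀ r ∉ D, r ≠ a → key (p r) < key d) :
    Stage P (Function.update p a d) c a D s T q := by
  have hne : ∀ r ∈ D, r ≠ a := fun r hr hra => h.notMem (hra ▸ hr)
  refine ⟨h.injective_update (fun r hr => key_lt_iff.2 (Or.inl (hgt r hr))) hlt, h.notMem,
    h.colour_of_mem, h.colour_of_notMem, fun r hr => ?_, fun r hr hra => ?_, h.pos, ?_,
    fun r hr hra => ?_⟩
  · simpa [hne r hr] using hgt r hr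
  · simpa [hra] using hlt r hr hra
  · rw [← h.image]
    exact Set.image_congr fun r hr => by simp [hne r hr]
  · simpa [hra] using h.low r hr hra

/-- A movement of `a` that keeps its colour leaves all colours unchanged. The new height of `a`
has to be strictly below the placed robots, which keeps `Stage` valid (`Stage.update`). -/
theorem adjust (hF : ∀ r, (F r).axes = LinearIsometryEquiv.refl ℝ Plane)
    (h : Stage P p c a D s T q) {d : Plane} (ha : act algorithm P F p c a = (0, d))
    (hgt : ∀ r ∈ D, d 1 < (p r) 1) (hlt : ∀ r ∉ D, r ≠ a → key (p r) < key d) :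
    SoloStep algorithm P F (p, c) (Function.update p a d, c) := by
  have := h.soloStep hF ha (by decide) (fun r hr => key_lt_iff.2 (Or.inl (hgt r hr))) hlt
  have hc : Function.update c a 0 = c :=
    Function.update_eq_self_iff.2 (h.colour_of_notMem a h.notMem).symm
  rwa [hc] at this

theorem exists_level (hF : ∀ r, (F r).axes = LinearIsometryEquiv.refl ℝ Plane)
    (h : Stage P p c a D s T q) :
    ∃ d, Relation.ReflTransGen (SoloStep algorithm P F) (p, c) (Function.update p a d, c) ∧
      (∀ r ∈ D, d 1 < (p r) 1) ∧ ∀ r ∉ D, r ≠ a → (p r) 1 < d 1 := by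
  have hu := (F a).unit_pos
  by_cases hlev : ∃ z ∈ snapshot (F a) p c a, z.1 1 = 0
  · have hex : ∃ y : ℝ, 0 < y ∧ ∀ z ∈ Prod.fst '' snapshot (F a) p c a,
        key 0 < key z → y < z 1 := by
      rcases D.eq_empty_or_nonempty with rfl | ⟨r, hr⟩
      · refine ⟨1, one_pos, fun z hz hz0 => ?_⟩
        obtain ⟨r, -, -, rfl⟩ := mem_fst_snapshot.1 hz
        rw [toLocal_eq hF, key_zero_lt_iff (inv_pos.2 hu), h.key_lt_iff_mem] at hz0
        exact hz0.elim
      · obtain ⟨t, ht, -, hmin⟩ := exists_visible_succ h.inj ⟨r, h.key_above r hr⟩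
        have htp := h.above t ((h.key_lt_iff_mem t).1 ht)
        refine ⟨(F a).unit⁻¹ * (((p t) 1 - (p a) 1) / 2),
          mul_pos (inv_pos.2 hu) (by linarith), fun z hz hz0 => ?_⟩
        obtain ⟨v, -, -, rfl⟩ := mem_fst_snapshot.1 hz
        rw [toLocal_eq hF, key_zero_lt_iff (inv_pos.2 hu)] at hz0
        rw [toLocal_eq hF]
        have := le_of_key_le (hmin v hz0)
        simp only [PiLp.smul_apply, PiLp.sub_apply, smul_eq_mul]
        exact mul_lt_mul_of_pos_left (by linarith) (inv_pos.2 hu)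
    have hy : climb (Prod.fst '' snapshot (F a) p c a) = hex.choose := by
      rw [climb, dif_pos hex]
    obtain ⟨hy0, hyV⟩ := hex.choose_spec
    rw [← hy] at hy0 hyV
    generalize climb (Prod.fst '' snapshot (F a) p c a) = y at hy0 hyV hy
    have hgt : ∀ r ∈ D, (p a) 1 + (F a).unit * y < (p r) 1 := by
      intro r hr
      obtain ⟨t, ht, htv, hmin⟩ := exists_visible_succ h.inj ⟨r, h.key_above r hr⟩
      have h1 := hyV _ (mem_fst_snapshot.2 ⟨t, fun hta => by simp [hta] at ht, htv, rfl⟩)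
        (by rwa [toLocal_eq hF, key_zero_lt_iff (inv_pos.2 hu)])
      rw [toLocal_eq hF] at h1
      simp only [PiLp.smul_apply, PiLp.sub_apply, smul_eq_mul] at h1
      rw [lt_inv_mul_iff₀ hu] at h1
      linarith [le_of_key_le (hmin r (h.key_above r hr))]
    have hlt : ∀ r ∉ D, r ≠ a → (p r) 1 < (p a) 1 + (F a).unit * y := fun r hr hra => by
      linarith [le_of_key_le (h.below r hr hra).le, mul_pos hu hy0]
    refine ⟨p a + (F a).unit • y • EuclideanSpace.single 1 (1 : ℝ), .single ?_, ?_, ?_⟩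
    · refine h.adjust hF ?_ (by simpa using hgt)
        fun r hr hra => key_lt_iff.2 (Or.inl (by simpa using hlt r hr hra))
      simp only [act, algorithm, if_pos (h.turn hF), if_pos hlev, toGlobal_eq hF]
      rw [climb, dif_pos hex, ← hy]
    · simpa using hgt
    · simpa using hlt
  · refine ⟨p a, by rw [Function.update_eq_self], h.above, fun r hr hra => ?_⟩
    obtain ⟨t, ht, htv, hmax⟩ := exists_visible_pred h.inj ⟨r, h.below r hr hra⟩
    have h1 := le_of_key_le (hmax r (h.below r hr hra))
    refine lt_of_le_of_lt h1 (lt_of_le_of_ne (le_of_key_le ht.le) fun heq => hlev ?_)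
    exact (exists_mem_snapshot_level hF).2 ⟨t, fun hta => by simp [hta] at ht, htv, heq⟩

theorem exists_visible (hF : ∀ r, (F r).axes = LinearIsometryEquiv.refl ℝ Plane)
    (h : Stage P p c a D s T q) (hlev : ∀ r ∉ D, r ≠ a → (p r) 1 < (p a) 1) :
    ∃ d, Relation.ReflTransGen (SoloStep algorithm P F) (p, c) (Function.update p a d, c) ∧
      d 1 = (p a) 1 ∧ ∀ r, r ≠ a → Visible (Function.update p a d) a r := by
  classical
  have hu := (F a).unit_pos
  have hne : ∀ r, r ≠ a → (p r) 1 ≠ (p a) 1 := fun r hra => by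
    by_cases hr : r ∈ D
    · exact (h.above r hr).ne'
    · exact (hlev r hr hra).ne
  have hex := exists_shift_visible h.inj a hne hu.ne'
  let d : ℕ → Plane := fun i => p a + ((i : ℝ) * (F a).unit) • EuclideanSpace.single 0 (1 : ℝ)
  have hd1 : ∀ i, (d i) 1 = (p a) 1 := fun i => by simp [d]
  have hstage : ∀ i, Stage P (Function.update p a (d i)) c a D s T q := fun i =>
    h.update (fun r hr => by rw [hd1]; exact h.above r hr)
      fun r hr hra => key_lt_iff.2 (Or.inl (by rw [hd1]; exact hlev r hr hra))
  refine ⟨d (Nat.find hex), ?_, hd1 _, Nat.find_spec hex⟩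
  have key : ∀ i ≤ Nat.find hex,
      Relation.ReflTransGen (SoloStep algorithm P F) (p, c) (Function.update p a (d i), c) := by
    intro i
    induction i with
    | zero => intro _; simp [d, Relation.ReflTransGen.refl]
    | succ i ih =>
      intro hi
      refine (ih (by omega)).tail ?_
      have hi' := Nat.find_min hex (Nat.lt_of_succ_le hi)
      have hst := hstage i
      have hgt : ∀ r ∈ D, (d (i + 1)) 1 < (Function.update p a (d i) r) 1 := fun r hr => by
        rw [hd1, ← hd1 i]
        simpa using hst.above r hr
      have hlt : ∀ r ∉ D, r ≠ a →
          Robots.key (Function.update p a (d i) r) < Robots.key (d (i + 1)) := fun r hr hra => by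
        refine key_lt_iff.2 (Or.inl ?_)
        rw [hd1, Function.update_of_ne hra]
        exact hlev r hr hra
      have hact : act algorithm P F (Function.update p a (d i)) c a = (0, d (i + 1)) := by
        have h1 : ¬ ∃ z ∈ snapshot (F a) (Function.update p a (d i)) c a, z.1 1 = 0 := by
          rw [exists_mem_snapshot_level hF]
          rintro ⟨r, hra, -, hr⟩
          rw [Function.update_of_ne hra, Function.update_self, hd1] at hr
          exact hne r hra hr
        have h2 : ¬ (snapshot (F a) (Function.update p a (d i)) c a).ncard + 1 = n := by
          rw [ncard_snapshot_iff hF hst.inj]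
          exact hi'
        simp only [act, algorithm, if_pos (hst.turn hF), if_neg h1, if_neg h2, toGlobal_eq hF]
        simp only [Function.update_self, d, Nat.cast_add, Nat.cast_one, add_mul, one_mul,
          add_smul, add_assoc]
      have := hst.adjust hF hact hgt hlt
      rwa [Function.update_idem] at this
  exact key _ le_rfl

/-- A robot that sees all others, none of them at its height, goes to the next point of a copy
of the pattern. The copy is chosen by this robot; it contains the robots placed before. -/
theorem exists_place (hF : ∀ r, (F r).axes = LinearIsometryEquiv.refl ℝ Plane)
    (h : Stage P p c a D s T q) (hlev : ∀ r ∉ D, r ≠ a → (p r) 1 < (p a) 1)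
    (hvis : ∀ r, r ≠ a → Visible p a r) :
    ∃ s' T' q', Stage P p c a D s' T' q' ∧
      SoloStep algorithm P F (p, c)
        (Function.update p a (T' + s' • P q'), Function.update c a 1) := by
  have hu := (F a).unit_pos
  have hui := inv_pos.2 hu
  have hne : ∀ r ∈ D, r ≠ a := fun r hr hra => h.notMem (hra ▸ hr)
  -- the copy `T + s • P` in the local coordinates of `a`
  have hloc : ∀ (s : ℝ) (T : Plane) (j : Fin n),
      (F a).unit⁻¹ • (T - p a) + ((F a).unit⁻¹ * s) • P j =
        (F a).unit⁻¹ • ((T + s • P j) - p a) := by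
    intro s T j; rw [mul_smul, ← smul_add]; congr 1; abel
  have hmem : ∀ {z}, z ∈ Prod.fst '' snapshot (F a) p c a ↔
      ∃ r, r ≠ a ∧ z = (F a).unit⁻¹ • (p r - p a) := by
    intro z
    rw [mem_fst_snapshot]
    constructor
    · rintro ⟨r, h1, -, h2⟩; exact ⟨r, h1, by rw [h2, toLocal_eq hF]⟩
    · rintro ⟨r, h1, h2⟩; exact ⟨r, h1, hvis r h1, by rw [h2, toLocal_eq hF]⟩
  have habove : {z ∈ Prod.fst '' snapshot (F a) p c a | key 0 < key z} =
      (fun x => (F a).unit⁻¹ • (x - p a)) '' (p '' D) := by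
    ext z
    simp only [mem_ofPred_eq, hmem, Set.image_image, mem_image]
    constructor
    · rintro ⟨⟨r, -, rfl⟩, h0⟩
      exact ⟨r, (h.key_lt_iff_mem r).1 ((key_zero_lt_iff hui _ _).1 h0), rfl⟩
    · rintro ⟨r, hr, rfl⟩
      exact ⟨⟨r, hne r hr, rfl⟩, (key_zero_lt_iff hui _ _).2 (h.key_above r hr)⟩
  have hfits : ∀ s T q, Fits P (Prod.fst '' snapshot (F a) p c a) ((F a).unit⁻¹ * s)
      ((F a).unit⁻¹ • (T - p a)) q ↔ (0 < s ∧
        p '' D = (fun j => T + s • P j) '' {j | key (P q) < key (P j)} ∧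
        ∀ r ∉ D, r ≠ a → ∀ j, (p r) 1 < (T + s • P j) 1) := by
    intro s T q
    have hinj : Function.Injective fun x => (F a).unit⁻¹ • (x - p a) := fun x y hxy =>
      sub_left_injective (smul_right_injective _ hui.ne' hxy)
    have him : (fun j => (F a).unit⁻¹ • (T - p a) + ((F a).unit⁻¹ * s) • P j) ''
        {j | key (P q) < key (P j)} = (fun x => (F a).unit⁻¹ • (x - p a)) ''
          ((fun j => T + s • P j) '' {j | key (P q) < key (P j)}) := by
      rw [Set.image_image]; exact Set.image_congr fun j _ => hloc s T j
    have hlow : ∀ r j, ((F a).unit⁻¹ • (p r - p a)) 1 <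
        ((F a).unit⁻¹ • (T - p a) + ((F a).unit⁻¹ * s) • P j) 1 ↔
          (p r) 1 < (T + s • P j) 1 := by
      intro r j
      rw [hloc, PiLp.smul_apply, PiLp.smul_apply, smul_eq_mul, smul_eq_mul,
        mul_lt_mul_iff_right₀ hui, PiLp.sub_apply, PiLp.sub_apply, sub_lt_sub_iff_right]
    constructor
    · rintro ⟨h1, h2, h3⟩
      rw [habove, him] at h2
      refine ⟨pos_of_mul_pos_right h1 hui.le, hinj.image_injective h2, fun r hr hra j => ?_⟩
      exact (hlow r j).1 (h3 _ (hmem.2 ⟨r, hra, rfl⟩)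
        ((key_lt_zero_iff hui _ _).2 (h.below r hr hra)) j)
    · rintro ⟨h1, h2, h3⟩
      refine ⟨mul_pos hui h1, by rw [habove, him, h2], fun z hz hz0 j => ?_⟩
      obtain ⟨r, hra, rfl⟩ := hmem.1 hz
      rw [key_lt_zero_iff hui] at hz0
      exact (hlow r j).2 (h3 r (fun hr => lt_asymm hz0 (h.key_above r hr)) hra j)
  have hex : ∃ x : ℝ × Plane × Fin n,
      Fits P (Prod.fst '' snapshot (F a) p c a) x.1 x.2.1 x.2.2 :=
    ⟨(_, _, q), (hfits s T q).2 ⟨h.pos, h.image, h.low⟩⟩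
  obtain ⟨s', T', q', hch⟩ : ∃ s' T' q',
      hex.choose = ((F a).unit⁻¹ * s', (F a).unit⁻¹ • (T' - p a), q') := by
    refine ⟨(F a).unit * hex.choose.1, p a + (F a).unit • hex.choose.2.1, hex.choose.2.2, ?_⟩
    refine Prod.ext ?_ (Prod.ext ?_ rfl)
    · simp [hu.ne']
    · simp [hu.ne']
  have hspec := hex.choose_spec
  rw [hch] at hspec
  obtain ⟨h1, h2, h3⟩ := (hfits s' T' q').1 hspec
  refine ⟨s', T', q', ⟨h.inj, h.notMem, h.colour_of_mem, h.colour_of_notMem, h.above, h.below,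
    h1, h2, h3⟩, ?_⟩
  refine h.soloStep hF ?_ (by decide) (fun r hr => ?_)
    fun r hr hra => key_lt_iff.2 (Or.inl (h3 r hr hra q'))
  · have hl : ¬ ∃ z ∈ snapshot (F a) p c a, z.1 1 = 0 := by
      rw [exists_mem_snapshot_level hF]
      rintro ⟨r, hra, -, hr⟩
      by_cases hrD : r ∈ D
      · exact (h.above r hrD).ne' hr
      · exact (hlev r hrD hra).ne hr
    simp only [act, algorithm, if_pos (h.turn hF), if_neg hl,
      if_pos ((ncard_snapshot_iff hF h.inj).2 hvis), toGlobal_eq hF]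
    rw [target, dif_pos hex, hch, hloc]
    simp [hu.ne']
  · obtain ⟨j, hj, hjr⟩ := (h2.subset (mem_image_of_mem p hr) : _)
    rw [← hjr]
    exact (key_add_smul_lt_iff h1 _ _ _).2 hj

end Stage

/-! ### All robots taking their places -/

/-- The robots in `D` are placed on the points `T + s • P j`, `j ∈ U`, of a copy of the pattern,
where `U` is closed upwards, and the other robots are lower than the whole copy. -/
structure Partial (P p : Fin n → Plane) (c : Fin n → Fin 3) (D U : Set (Fin n)) (s : ℝ)
    (T : Plane) : Prop where
  inj : Function.Injective p
  colour_of_mem : ∀ r ∈ D, c r = 2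
  colour_of_notMem : ∀ r ∉ D, c r = 0
  pos : 0 < s
  upper : ∀ i ∈ U, ∀ j ∉ U, key (P j) < key (P i)
  image : p '' D = (fun j => T + s • P j) '' U
  low : ∀ r ∉ D, ∀ j, (p r) 1 < (T + s • P j) 1

namespace Partial

variable {U : Set (Fin n)}

theorem ncard_eq (hP : Function.Injective P) (h : Partial P p c D U s T) :
    D.ncard = U.ncard := by
  rw [← Set.ncard_image_of_injective D h.inj, h.image, Set.ncard_image_of_injective]
  intro i j hij
  exact hP (smul_right_injective _ h.pos.ne' (add_right_injective T hij))

theorem exists_stage (hP : Function.Injective P) (h : Partial P p c D U s T) (hD : D ≠ univ) :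
    ∃ a q, Stage P p c a D s T q := by
  have hU : U ≠ univ := fun hU => by
    refine hD (Set.eq_of_subset_of_ncard_le (subset_univ _) ?_)
    rw [h.ncard_eq hP, hU]
  obtain ⟨a, ha, hmax⟩ := (toFinite Dᶜ).exists_maximalFor (fun r => key (p r)) Dᶜ
    (nonempty_compl.2 hD)
  obtain ⟨q, hq, hqmax⟩ := (toFinite Uᶜ).exists_maximalFor (fun j => key (P j)) Uᶜ
    (nonempty_compl.2 hU)
  have hUq : {j | key (P q) < key (P j)} = U := by
    ext j
    refine ⟨fun hj => ?_, fun hj => h.upper j hj q hq⟩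
    by_contra hjU
    exact absurd (hqmax hjU hj.le) (not_le.2 hj)
  refine ⟨a, q, h.inj, ha, h.colour_of_mem, h.colour_of_notMem, fun r hr => ?_,
    fun r hr hra => ?_, h.pos, by rw [hUq, h.image], fun r hr _ => h.low r hr⟩
  · obtain ⟨j, -, hj⟩ := h.image.subset (mem_image_of_mem p hr)
    rw [← hj]
    exact h.low a ha j
  · refine lt_of_le_of_ne ((le_total (key (p r)) (key (p a))).elim id fun h' => hmax hr h') ?_
    exact fun heq => hra (h.inj (key_injective heq))

/-- The highest robot that is not placed gets placed. -/
theorem exists_next (hF : ∀ r, (F r).axes = LinearIsometryEquiv.refl ℝ Plane)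
    (hP : Function.Injective P) (h : Partial P p c D U s T) (hD : D ≠ univ) :
    ∃ p' c' a U' s' T', a ∉ D ∧
      Relation.ReflTransGen (SoloStep algorithm P F) (p, c) (p', c') ∧
      Partial P p' c' (insert a D) U' s' T' := by
  obtain ⟨a, q, hst⟩ := h.exists_stage hP hD
  obtain ⟨d, hreach, hd1, hd2⟩ := hst.exists_level hF
  have hst1 := hst.update hd1 fun r hr hra => key_lt_iff.2 (Or.inl (hd2 r hr hra))
  have hlev1 : ∀ r ∉ D, r ≠ a →
      (Function.update p a d r) 1 < (Function.update p a d a) 1 := fun r hr hra => by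
    simpa [hra] using hd2 r hr hra
  obtain ⟨d', hreach', hd', hvis⟩ := hst1.exists_visible hF hlev1
  simp only [Function.update_idem, Function.update_self] at hreach' hd' hvis
  have hst2 : Stage P (Function.update p a d') c a D s T q :=
    hst.update (fun r hr => by rw [hd']; exact hd1 r hr)
      fun r hr hra => key_lt_iff.2 (Or.inl (by rw [hd']; exact hd2 r hr hra))
  obtain ⟨s', T', q', hst3, hstep⟩ := hst2.exists_place hF
    (fun r hr hra => by simpa [hra, hd'] using hd2 r hr hra) hvis
  simp only [Function.update_idem] at hstep
  have hne : ∀ r ∈ D, r ≠ a := fun r hr hra => hst.notMem (hra ▸ hr)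
  have hDimg : p '' D = (fun j => T' + s' • P j) '' {j | key (P q') < key (P j)} := by
    rw [← hst3.image]
    exact Set.image_congr fun r hr => by simp [hne r hr]
  have hgt : ∀ r ∈ D, key (T' + s' • P q') < key (p r) := fun r hr => by
    obtain ⟨j, hj, hjr⟩ := hDimg.subset (mem_image_of_mem p hr)
    rw [← hjr]
    exact (key_add_smul_lt_iff hst3.pos _ _ _).2 hj
  have hlow : ∀ r ∉ D, r ≠ a → ∀ j, (p r) 1 < (T' + s' • P j) 1 := fun r hr hra j => by
    simpa [hra] using hst3.low r hr hra j
  have hlt : ∀ r ∉ D, r ≠ a → key (p r) < key (T' + s' • P q') := fun r hr hra =>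
    key_lt_iff.2 (Or.inl (hlow r hr hra q'))
  have hinj := hst.injective_update hgt hlt
  -- having arrived, `a` changes its colour from `1` to `2`
  have hlast : SoloStep algorithm P F
      (Function.update p a (T' + s' • P q'), Function.update c a 1)
      (Function.update p a (T' + s' • P q'), Function.update c a 2) := by
    have := SoloStep.recolour (A := algorithm) (P := P) (F := F)
      (Function.update p a (T' + s' • P q')) (Function.update c a 1) a 2
      (act_eq_of_one (by simp)) fun r hr => act_eq_of_between (D := D) (a := a) hF hinj
        (fun r hr => by simp [hne r hr, hst.colour_of_mem r hr])
        (fun r hr hra => by simp [hra, hst.colour_of_notMem r hr]) (by simp)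
        (fun r hr => by simpa [hne r hr] using hgt r hr)
        (fun r hr hra => by simpa [hra] using hlt r hr hra) r hr
    rwa [Function.update_idem] at this
  refine ⟨_, _, a, {j | key (P q') ≤ key (P j)}, s', T', hst.notMem,
    ((hreach.trans hreach').tail hstep).tail hlast, hinj, ?_, ?_, hst3.pos, ?_, ?_, ?_⟩
  · rintro r (rfl | hr)
    · simp
    · simp [hne r hr, hst.colour_of_mem r hr]
  · intro r hr
    obtain ⟨hra, hrD⟩ : r ≠ a ∧ r ∉ D := by simpa [not_or] using hr
    simp [hra, hst.colour_of_notMem r hrD]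
  · intro i hi j hj
    exact lt_of_lt_of_le (not_le.1 hj) hi
  · have hset : {j | key (P q') ≤ key (P j)} = insert q' {j | key (P q') < key (P j)} := by
      ext j
      simp only [mem_ofPred_eq, mem_insert_iff, le_iff_eq_or_lt]
      exact or_congr_left ⟨fun h => (hP (key_injective h)).symm, fun h => h ▸ rfl⟩
    rw [hset, Set.image_insert_eq, Set.image_insert_eq, ← hDimg, Function.update_self]
    congr 1
    exact Set.image_congr fun r hr => by simp [hne r hr]
  · intro r hr j
    obtain ⟨hra, hrD⟩ : r ≠ a ∧ r ∉ D := by simpa [not_or] using hr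
    simpa [hra] using hlow r hrD hra j

theorem exists_all (hF : ∀ r, (F r).axes = LinearIsometryEquiv.refl ℝ Plane)
    (hP : Function.Injective P) (h : Partial P p c D U s T) :
    ∃ p' c' U' s' T', Relation.ReflTransGen (SoloStep algorithm P F) (p, c) (p', c') ∧
      Partial P p' c' univ U' s' T' := by
  induction hm : Dᶜ.ncard generalizing p c D U s T with
  | zero =>
    have hD : D = univ := by
      rwa [Set.ncard_eq_zero, Set.compl_empty_iff] at hm
    subst hD
    exact ⟨p, c, U, s, T, .refl, h⟩
  | succ m ih =>
    have hD : D ≠ univ := by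
      rintro rfl
      simp at hm
    obtain ⟨p', c', a, U', s', T', ha, hreach, h'⟩ := h.exists_next hF hP hD
    obtain ⟨p'', c'', U'', s'', T'', hreach', h''⟩ := ih h' (by
      have h1 := Set.ncard_add_ncard_compl D
      have h2 := Set.ncard_add_ncard_compl (insert a D)
      rw [Set.ncard_insert_of_notMem ha] at h2
      omega)
    exact ⟨p'', c'', U'', s'', T'', hreach.trans hreach', h''⟩

end Partial

/-- With no robot placed, any copy of the pattern that is high enough will do. -/
theorem exists_partial_empty (P : Fin n → Plane) (hp : Function.Injective p) :
    ∃ T, Partial P p (fun _ => 0) ∅ ∅ 1 T := by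
  obtain ⟨M, hM⟩ := (finite_range fun r => (p r) 1).bddAbove
  obtain ⟨m, hm⟩ := (finite_range fun j => (P j) 1).bddBelow
  refine ⟨(M - m + 1) • EuclideanSpace.single 1 (1 : ℝ), hp, by simp, by simp, one_pos,
    by simp, by simp, fun r _ j => ?_⟩
  have h1 : (p r) 1 ≤ M := hM ⟨r, rfl⟩
  have h2 : m ≤ (P j) 1 := hm ⟨j, rfl⟩
  simp
  linarith

end Act

/-! ### Arbitrary pattern formation -/

/-- A complete placement forms the pattern, also for robots whose axes differ from the standard
ones by `L`. -/
theorem Partial.formsPattern {n : ℕ} {P p : Fin n → Plane} {c : Fin n → Fin 3}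
    {U : Set (Fin n)} {s : ℝ} {T : Plane} (hP : Function.Injective P)
    (h : Partial P p c univ U s T) (L : Plane ≃ₗᵢ[ℝ] Plane) :
    FormsPattern (fun r => L.symm (p r)) P := by
  have hU : U = univ := Set.eq_of_subset_of_ncard_le (subset_univ _) (h.ncard_eq hP).le
  have himg := h.image
  rw [hU, image_univ, image_univ] at himg
  refine ⟨s⁻¹, L, -(s⁻¹ • T), inv_pos.2 h.pos, ?_⟩
  have h1 : (range fun r => L.symm (p r)) = L.symm '' range p := range_comp L.symm p
  rw [h1, himg, ← range_comp, ← range_comp]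
  congr 1
  funext j
  simp [h.pos.ne']

end Robots
end

theorem mainTheorem2 :
    ∃ A : Robots.Algorithm (Fin 3),
      ∀ (n : ℕ) (P : Fin n → Robots.Plane), Function.Injective P →
        ∀ R : Robots.Run n (Fin 3),
          R.IsExecution 0 A P →
          Robots.TwoAxisAgreement R.frame →
          (Function.Injective fun r => R.pos r 0) →
          Robots.AchievesAPF R A P := by
  refine ⟨Robots.algorithm, fun n P hP R hR hF hinj => ?_⟩
  obtain ⟨L, hL⟩ : ∃ L, ∀ r, (R.frame r).axes = L := by
    cases n with
    | zero => exact ⟨LinearIsometryEquiv.refl ℝ Robots.Plane, fun r => r.elim0⟩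
    | succ n => exact ⟨(R.frame 0).axes, fun r => hF r 0⟩
  -- in the coordinates given by the common axes, all frames are standard
  obtain ⟨T₀, h0⟩ := Robots.exists_partial_empty P (L.injective.comp hinj)
  obtain ⟨p, c, U, s, T, hreach, h⟩ :=
    h0.exists_all (F := fun r => (R.frame r).standard) (fun _ => rfl) hP
  obtain rfl : c = fun _ => 2 := funext fun r => h.colour_of_mem r (Set.mem_univ r)
  have hreach' : Relation.ReflTransGen (Robots.SoloStep Robots.algorithm P R.frame)
      (fun r => R.pos r 0, fun _ => 0) (fun r => L.symm (p r), fun _ => 2) := by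
    have := hreach.lift
      (fun x : (Fin n → Robots.Plane) × (Fin n → Fin 3) => (fun r => L.symm (x.1 r), x.2))
      fun _ _ hxy => Robots.SoloStep.of_map hL hxy
    simpa [Function.onFun, Function.comp_def] using this
  exact hR.achievesAPF hinj hreach' (fun r => Robots.act_eq_of_two rfl) (h.formsPattern hP L)
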